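/- Let $d\ge 1$ and $0\le t\le d$ be integers, let $\mathcal G_{1,d}=\{P\in\mathbb R^{d\times d}: P^\top=P,\ P^2=P,\ \operatorname{tr}P=1\}$, and let $\sigma_{1,d}$ be the orthogonally invariant probability measure on $\mathcal G_{1,d}$ induced by the Haar measure on the orthogonal group $\mathcal O(d)$ acting by $P\mapsto UPU^\top$. For symmetric matrices $M_1,\dots,M_t\in\mathbb R^{d\times d}$ put $$\mu_{1,d}(M_1,\dots,M_t)=\int_{\mathcal G_{1,d}}\prod_{i=1}^t\operatorname{tr}(PM_i)\,d\sigma_{1,d}(P).$$ For a cycle $c=(c_1\,c_2\,\dots\,c_\ell)$ of a permutation $s\in S_t$ (fixed points count as cycles of length one) put $M_c=M_{c_1}M_{c_2}\cdots M_{c_\ell}$; the number $\operatorname{tr}(M_c)$ does not depend on the element at which the cycle is started. Write $\mathscr P_t$ for the set of partitions of $t$, and $s\sim\pi$ if the cycle lengths of $s$ are the parts of $\pi\in\mathscr P_t$. Then there are real coefficients $(\alpha_\pi)_{\pi\in\mathscr P_t}$ such that $$\mu_{1,d}(M_1,\dots,M_t)=\sum_{\pi\in\mathscr P_t}\alpha_\pi\sum_{\substack{s\in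 S_t\\ s\sim\pi}}\ \prod_{c\in s}\operatorname{tr}(M_c)\qquad\text{for all symmetric } M_1,\dots,M_t\in\mathbb R^{d\times d},$$ and any real coefficients $(\alpha_\pi)_{\pi\in\mathscr P_t}$ with this property satisfy $\alpha_\pi>0$ for every $\pi\in\mathscr P_t$. -/

import Mathlib

open MeasureTheory Matrix

namespace TraceMoments

/-! ### The orthogonal group `O(d)`, with its Borel structure -/

/-- Real orthogonal matrices carry the Borel sigma-algebra of the subspace topology. -/
instance orthogonalMeasurableSpace (d : ℕ) : MeasurableSpace (orthogonalGroup (Fin d) ℝ) :=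
  borel _

instance orthogonalBorelSpace (d : ℕ) : BorelSpace (orthogonalGroup (Fin d) ℝ) := ⟨rfl⟩

instance orthogonalTopologicalGroup (d : ℕ) :
    IsTopologicalGroup (orthogonalGroup (Fin d) ℝ) :=
  inferInstanceAs (IsTopologicalGroup (unitary (Matrix (Fin d) (Fin d) ℝ)))

instance orthogonalCompactSpace (d : ℕ) : CompactSpace (orthogonalGroup (Fin d) ℝ) := by
  suffices h : IsCompact (orthogonalGroup (Fin d) ℝ : Set (Matrix (Fin d) (Fin d) ℝ)) from
    isCompact_iff_compactSpace.1 h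
  have hK : IsCompact (Set.univ.pi fun _ : Fin d => Set.univ.pi fun _ : Fin d =>
      Set.Icc (-1 : ℝ) 1) :=
    isCompact_univ_pi fun _ => isCompact_univ_pi fun _ => isCompact_Icc
  refine IsCompact.of_isClosed_subset (X := Matrix (Fin d) (Fin d) ℝ) hK ?_ ?_
  · have : (orthogonalGroup (Fin d) ℝ : Set (Matrix (Fin d) (Fin d) ℝ)) =
        {A | A * star A = 1} := by
      ext A
      exact mem_orthogonalGroup_iff (Fin d) ℝ
    rw [this]
    exact isClosed_eq (continuous_id.mul continuous_star) continuous_const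
  · intro U hU i _ j _
    have h := entry_norm_bound_of_unitary (𝕜 := ℝ) hU i j
    rw [Real.norm_eq_abs] at h
    exact abs_le.mp h

/-- The Haar measure of `O(d)`, normalised to total mass one. -/
noncomputable def orthogonalHaar (d : ℕ) : Measure (orthogonalGroup (Fin d) ℝ) :=
  Measure.haarMeasure ⊤

instance orthogonalHaar_isProbabilityMeasure (d : ℕ) :
    IsProbabilityMeasure (orthogonalHaar d) :=
  ⟨by simpa [orthogonalHaar] using
    Measure.haarMeasure_self (K₀ := (⊤ : TopologicalSpace.PositiveCompacts
      (orthogonalGroup (Fin d) ℝ)))⟩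

/-! ### The Grassmannian and its orthogonally invariant probability measure -/

/-- The Grassmannian `G_{k,d}`: the real symmetric `d × d` matrices `P` with
`P ^ 2 = P` and trace `k`. -/
def Grassmannian (k d : ℕ) : Type :=
  {P : Matrix (Fin d) (Fin d) ℝ // P.IsSymm ∧ P * P = P ∧ P.trace = k}

instance grassmannianTopologicalSpace (k d : ℕ) : TopologicalSpace (Grassmannian k d) :=
  instTopologicalSpaceSubtype

instance grassmannianMeasurableSpace (k d : ℕ) : MeasurableSpace (Grassmannian k d) :=
  borel _

instance grassmannianBorelSpace (k d : ℕ) : BorelSpace (Grassmannian k d) := ⟨rfl⟩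

/-- The action of `O(d)` on `G_{k,d}` by conjugation. -/
def conj {k d : ℕ} (U : orthogonalGroup (Fin d) ℝ) (P : Grassmannian k d) :
    Grassmannian k d :=
  ⟨U.1 * P.1 * U.1ᵀ, by
    obtain ⟨P, hs, hi, ht⟩ := P
    have hU : U.1ᵀ * U.1 = 1 := (mem_orthogonalGroup_iff' (Fin d) ℝ).1 U.2
    refine ⟨?_, ?_, ?_⟩
    · rw [IsSymm, transpose_mul, transpose_mul, transpose_transpose, hs.eq, Matrix.mul_assoc]
    · calc U.1 * P * U.1ᵀ * (U.1 * P * U.1ᵀ) = U.1 * P * (U.1ᵀ * U.1) * P * U.1ᵀ := by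
            simp only [Matrix.mul_assoc]
        _ = U.1 * (P * P) * U.1ᵀ := by rw [hU]; simp only [Matrix.mul_assoc, Matrix.one_mul]
        _ = U.1 * P * U.1ᵀ := by rw [hi]
    · rw [trace_mul_comm, ← Matrix.mul_assoc, hU, Matrix.one_mul, ht]⟩

/-- The coordinate projection onto the first `k` coordinates, for `k ≤ d`. -/
def coordProj {k d : ℕ} (hk : k ≤ d) : Grassmannian k d :=
  ⟨diagonal fun i => if (i : ℕ) < k then 1 else 0, by
    refine ⟨isSymm_diagonal _, ?_, ?_⟩
    · rw [diagonal_mul_diagonal]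
      congr 1
      ext i
      split_ifs <;> simp
    · rw [trace_diagonal, Fin.sum_univ_eq_sum_range (fun i => if i < k then (1 : ℝ) else 0) d,
        Finset.sum_ite]
      have : (Finset.range d).filter (fun i => i < k) = Finset.range k := by
        ext i
        simp only [Finset.mem_filter, Finset.mem_range]
        omega
      simp [this]⟩

/-- `σ_{k,d}`: the image of the normalised Haar measure of `O(d)` under the orbit map of the
conjugation action. It is the orthogonally invariant probability measure on `G_{k,d}`. -/
noncomputable def grassmannMeasure {k d : ℕ} (hk : k ≤ d) : Measure (Grassmannian k d) :=
  (orthogonalHaar d).map fun U => conj U (coordProj hk)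

theorem continuous_conj {k d : ℕ} (P : Grassmannian k d) :
    Continuous fun U : orthogonalGroup (Fin d) ℝ => conj U P := by
  refine Continuous.subtype_mk ?_ _
  exact (continuous_subtype_val.matrix_mul continuous_const).matrix_mul
    continuous_subtype_val.matrix_transpose

instance grassmannMeasure_isProbabilityMeasure {k d : ℕ} (hk : k ≤ d) :
    IsProbabilityMeasure (grassmannMeasure hk) :=
  Measure.isProbabilityMeasure_map (continuous_conj _).measurable.aemeasurable

theorem grassmannMeasure_map_conj {k d : ℕ} (hk : k ≤ d) (U : orthogonalGroup (Fin d) ℝ) :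
    (grassmannMeasure hk).map (conj U) = grassmannMeasure hk := by
  have hc : Continuous (conj U : Grassmannian k d → Grassmannian k d) := by
    refine Continuous.subtype_mk ?_ _
    exact (continuous_const.matrix_mul continuous_subtype_val).matrix_mul continuous_const
  have hcomp : (conj U ∘ fun V => conj V (coordProj hk)) =
      (fun V => conj V (coordProj hk)) ∘ fun V => U * V := by
    ext V : 1
    apply Subtype.ext
    change U.1 * (V.1 * (coordProj hk).1 * V.1ᵀ) * U.1ᵀ =
      (U.1 * V.1) * (coordProj hk).1 * (U.1 * V.1)ᵀ
    simp only [transpose_mul, Matrix.mul_assoc]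
  have hinv : (orthogonalHaar d).map (fun V => U * V) = orthogonalHaar d := by
    unfold orthogonalHaar
    exact map_mul_left_eq_self _ U
  have hm : Measurable fun V => conj V (coordProj hk) := (continuous_conj _).measurable
  unfold grassmannMeasure
  rw [Measure.map_map hc.measurable hm, hcomp,
    ← Measure.map_map hm (continuous_const_mul U).measurable, hinv]

/-- The trace moment `μ_{k,d}(M_1, …, M_t) = ∫ ⟨P, M_1⟩ ⋯ ⟨P, M_t⟩ dσ_{k,d}(P)`, where
`⟨P, M⟩ = trace (P M)`. -/
noncomputable def traceMoment {k d t : ℕ} (hk : k ≤ d)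
    (M : Fin t → Matrix (Fin d) (Fin d) ℝ) : ℝ :=
  ∫ P, ∏ i, (P.1 * M i).trace ∂(grassmannMeasure hk)

/-! ### Products of cycle traces -/

/-- For the cycle `c = (x, s x, …, s ^ (l - 1) x)` of `s` through `x`, fixed points being cycles of
length one, this is `trace (M_c)` with `M_c = M_x * M_{s x} * ⋯ * M_{s ^ (l - 1) x}`. -/
noncomputable def cycleTraceAt {t d : ℕ} (s : Equiv.Perm (Fin t))
    (M : Fin t → Matrix (Fin d) (Fin d) ℝ) (x : Fin t) : ℝ :=
  (((List.range (Function.minimalPeriod s x)).map fun j => M ((s ^ j) x)).prod).trace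

theorem cycleTraceAt_apply {t d : ℕ} (s : Equiv.Perm (Fin t))
    (M : Fin t → Matrix (Fin d) (Fin d) ℝ) (x : Fin t) :
    cycleTraceAt s M (s x) = cycleTraceAt s M x := by
  have hx : x ∈ Function.periodicPts s :=
    Function.mem_periodicPts.2 ⟨orderOf s, orderOf_pos s, by
      rw [Function.IsPeriodicPt, Function.IsFixedPt, ← Equiv.Perm.coe_pow, pow_orderOf_eq_one]
      rfl⟩
  have hper : (s ^ Function.minimalPeriod s x) x = x := by
    have := Function.isPeriodicPt_minimalPeriod s x
    rwa [Function.IsPeriodicPt, Function.IsFixedPt, ← Equiv.Perm.coe_pow] at this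
  have hpos := Function.minimalPeriod_pos_of_mem_periodicPts hx
  unfold cycleTraceAt
  rw [Function.minimalPeriod_apply hx]
  obtain ⟨n, hn⟩ : ∃ n, Function.minimalPeriod s x = n + 1 :=
    ⟨_, (Nat.succ_pred_eq_of_pos hpos).symm⟩
  rw [hn] at hper ⊢
  have h1 : ∀ j, (s ^ j) (s x) = (s ^ (j + 1)) x := fun j => by
    rw [pow_succ, Equiv.Perm.mul_apply]
  rw [List.range_succ, List.map_append, List.prod_append, ← List.range_succ,
    List.range_succ_eq_map, List.map_cons, List.prod_cons, trace_mul_comm]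
  simp only [List.map_cons, List.map_nil, List.prod_cons, List.prod_nil, mul_one, h1, hper,
    List.map_map, Function.comp_def, Nat.succ_eq_add_one, pow_zero, Equiv.Perm.coe_one, id]

/-- The value of `trace (M_c)` does not depend on the point at which the cycle is opened. -/
theorem cycleTraceAt_sameCycle {t d : ℕ} (s : Equiv.Perm (Fin t))
    (M : Fin t → Matrix (Fin d) (Fin d) ℝ) {x y : Fin t} (h : s.SameCycle x y) :
    cycleTraceAt s M x = cycleTraceAt s M y := by
  obtain ⟨n, rfl⟩ := h.exists_nat_pow_eq
  induction n with
  | zero => rfl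
  | succ n ih =>
    rw [pow_succ', Equiv.Perm.mul_apply, cycleTraceAt_apply]
    exact ih ⟨n, by simp⟩

/-- The cycles of `s`, fixed points included as cycles of length one: the orbits of `s`. -/
abbrev Cycles {t : ℕ} (s : Equiv.Perm (Fin t)) : Type :=
  Quotient (Equiv.Perm.SameCycle.setoid s)

/-- `trace (M_c)` for a cycle `c` of `s`. -/
noncomputable def cycleTrace {t d : ℕ} (s : Equiv.Perm (Fin t))
    (M : Fin t → Matrix (Fin d) (Fin d) ℝ) (c : Cycles s) : ℝ :=
  Quotient.lift (s := Equiv.Perm.SameCycle.setoid s) (cycleTraceAt s M)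
    (fun _ _ h => cycleTraceAt_sameCycle s M h) c

noncomputable instance cyclesFintype {t : ℕ} (s : Equiv.Perm (Fin t)) : Fintype (Cycles s) :=
  Fintype.ofFinite _

/-! ### The expansion of the trace moments -/

/-- `s ∼ π`: the lengths of the cycles of `s`, fixed points included, are the parts of `π`. -/
def IsAssociated {t : ℕ} (s : Equiv.Perm (Fin t)) (π : t.Partition) : Prop :=
  s.partition.parts = π.parts

instance {t : ℕ} (s : Equiv.Perm (Fin t)) (π : t.Partition) : Decidable (IsAssociated s π) :=
  inferInstanceAs (Decidable (s.partition.parts = π.parts))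

/-- The real numbers `α_π`, indexed by the partitions `π` of `t`, are coefficients of an expansion
of the trace moments `μ_{k,d}(M_1, …, M_t)` of symmetric matrices in products of cycle traces. -/
def IsTraceExpansion {k d : ℕ} (hk : k ≤ d) (t : ℕ) (α : t.Partition → ℝ) : Prop :=
  ∀ M : Fin t → Matrix (Fin d) (Fin d) ℝ, (∀ i, (M i).IsSymm) →
    traceMoment hk M =
      ∑ π : t.Partition, α π *
        ∑ s : Equiv.Perm (Fin t) with IsAssociated s π, ∏ c : Cycles s, cycleTrace s M c

end TraceMoments

/-! The coefficients are explicit: `α_π = 2 ^ (t - #parts) / (d (d + 2) ⋯ (d + 2 (t - 1)))`, visibly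
positive. It remains to prove this expansion and to show that the coefficients are unique when `t ≤
d`.

Expansion (`prod_mul_traceMoment`): under `σ_{1,d}` one has `P = u uᵀ` for a random unit vector `u`,
so the moment integrates a product of quadratic forms. Differentiating its rotation invariance shows
that the moments with one `M_i` replaced by `M_i A - A M_i`, `A` skew, sum to zero. Taking `A = E_ab
- E_ba`, replacing `M_0` by `E_ab M_0` and summing over `a`, `b` gives a recursion in the number of
matrices (`traceMoment_succ`). The sum of cycle trace products weighted by `2 ^ (t - #cycles)` obeys
the same recursion (`cycleSum_succ`): a new point either becomes a fixed point or is inserted into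
an existing cycle, and only the latter doubles the weight.

Uniqueness (`isTraceExpansion_unique`): given `s`, choose symmetrised matrix units along the edges
`i — s i`, with `t` distinct vertices in `Fin d`. Every contraction is then nonnegative, the one
along `s` is positive, and only permutations with the orbits of `s` contribute. Evaluation there
isolates one coefficient. -/

namespace TraceMoments

/-! ### Products of cycle traces as index sums -/

section Contraction

variable {ι : Type*} [Fintype ι]

/-- The full contraction of the tensor `M_1 ⊗ ⋯ ⊗ M_t` along the permutation `s`. -/
def permContraction {t : ℕ} (s : Equiv.Perm (Fin t)) (M : Fin t → Matrix ι ι ℝ) : ℝ :=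
  ∑ k : Fin t → ι, ∏ i, M i (k i) (k (s i))

theorem sum_cons {n : ℕ} (g : (Fin (n + 1) → ι) → ℝ) :
    ∑ k, g k = ∑ a, ∑ k : Fin n → ι, g (Fin.cons a k) := by
  rw [← (Fin.consEquiv fun _ : Fin (n + 1) => ι).sum_comp, Fintype.sum_prod_type]
  rfl

/-- An entry of a matrix product is a sum over paths from `a` to `b`: `k` lists the inner vertices,
`Fin.cons a k` the row indices and `Fin.snoc k b` the column indices. -/
theorem prod_range_apply [DecidableEq ι] (n : ℕ) (f : ℕ → Matrix ι ι ℝ) (a b : ι) :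
    ((List.range (n + 1)).map f).prod a b =
      ∑ k : Fin n → ι, ∏ j : Fin (n + 1),
        f j ((Fin.cons a k : Fin (n + 1) → ι) j) ((Fin.snoc k b : Fin (n + 1) → ι) j) := by
  induction n generalizing f a with
  | zero =>
    rw [Fintype.sum_unique]
    simp [Fin.snoc]
  | succ n ih =>
    rw [List.range_succ_eq_map, List.map_cons, List.map_map, List.prod_cons, Matrix.mul_apply,
      sum_cons]
    refine Finset.sum_congr rfl fun c _ => ?_
    rw [ih (f ∘ Nat.succ) c, Finset.mul_sum]
    refine Finset.sum_congr rfl fun k _ => ?_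
    rw [Fin.prod_univ_succ (n := n + 1), ← Fin.cons_snoc_eq_snoc_cons]
    simp

/-- The path closes up, so column indices are row indices shifted cyclically. For `p = 0` this would
fail: the left side would be the trace of the identity, the right side `1`. -/
theorem trace_prod_range [DecidableEq ι] {p : ℕ} (hp : 0 < p) (f : ℕ → Matrix ι ι ℝ) :
    (((List.range p).map f).prod).trace =
      ∑ k : Fin p → ι, ∏ j : Fin p, f j (k j) (k (finRotate p j)) := by
  obtain ⟨n, rfl⟩ : ∃ n, p = n + 1 := ⟨p - 1, by omega⟩
  rw [Matrix.trace, sum_cons]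
  refine Finset.sum_congr rfl fun a _ => ?_
  rw [Matrix.diag_apply, prod_range_apply]
  simp only [Fin.snoc_eq_cons_rotate]

end Contraction

/-! ### Coordinates along the cycles of a permutation -/

theorem mem_periodicPts {t : ℕ} (s : Equiv.Perm (Fin t)) (x : Fin t) :
    x ∈ Function.periodicPts s :=
  Function.mem_periodicPts.2 ⟨orderOf s, orderOf_pos s, by
    rw [Function.IsPeriodicPt, Function.IsFixedPt, ← Equiv.Perm.coe_pow, pow_orderOf_eq_one]
    rfl⟩

theorem minimalPeriod_pos {t : ℕ} (s : Equiv.Perm (Fin t)) (x : Fin t) :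
    0 < Function.minimalPeriod s x :=
  Function.minimalPeriod_pos_of_mem_periodicPts (mem_periodicPts s x)

/-- A point of `Fin t` is determined by its cycle and its position on the cycle. -/
noncomputable def cyclePosition {t : ℕ} (s : Equiv.Perm (Fin t)) :
    (Σ c : Cycles s, Fin (Function.minimalPeriod s c.out)) ≃ Fin t :=
  Equiv.ofBijective (fun x => (s ^ (x.2 : ℕ)) x.1.out) <| by
    constructor
    · rintro ⟨c, j⟩ ⟨c', j'⟩ h
      have hc : c = c' := by
        rw [← Quotient.out_eq c, ← Quotient.out_eq c']
        refine Quotient.sound ?_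
        change s.SameCycle _ _
        have h1 : s.SameCycle c.out ((s ^ (j : ℕ)) c.out) := ⟨j, by simp⟩
        have h2 : s.SameCycle c'.out ((s ^ (j' : ℕ)) c'.out) := ⟨j', by simp⟩
        dsimp only at h
        rw [h] at h1
        exact h1.trans h2.symm
      subst hc
      simp only [Equiv.Perm.coe_pow] at h
      have := (Function.iterate_injOn_Iio_minimalPeriod (f := s) (x := c.out)) j.2 j'.2 h
      rw [Fin.ext this]
    · intro x
      have h : s.SameCycle (Quotient.mk (Equiv.Perm.SameCycle.setoid s) x).out x :=
        Quotient.mk_out (s := Equiv.Perm.SameCycle.setoid s) x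
      obtain ⟨n, hn⟩ := h.exists_nat_pow_eq
      refine ⟨⟨Quotient.mk _ x, ⟨n % _, Nat.mod_lt _ (minimalPeriod_pos s _)⟩⟩, ?_⟩
      dsimp only
      rw [Equiv.Perm.coe_pow, Function.iterate_mod_minimalPeriod_eq, ← Equiv.Perm.coe_pow, hn]

theorem cyclePosition_apply {t : ℕ} (s : Equiv.Perm (Fin t)) (c : Cycles s)
    (j : Fin (Function.minimalPeriod s c.out)) :
    cyclePosition s ⟨c, j⟩ = (s ^ (j : ℕ)) c.out := rfl

theorem cyclePosition_finRotate {t : ℕ} (s : Equiv.Perm (Fin t)) (c : Cycles s)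
    (j : Fin (Function.minimalPeriod s c.out)) :
    cyclePosition s ⟨c, finRotate _ j⟩ = s (cyclePosition s ⟨c, j⟩) := by
  have h : ((finRotate _ j : Fin _) : ℕ) = (j + 1) % Function.minimalPeriod s c.out := by
    have : NeZero (Function.minimalPeriod s c.out) := ⟨(minimalPeriod_pos s _).ne'⟩
    rw [finRotate_apply]
    simp [Fin.val_add]
  rw [cyclePosition_apply, cyclePosition_apply, h, Equiv.Perm.coe_pow,
    Function.iterate_mod_minimalPeriod_eq, Function.iterate_succ_apply', Equiv.Perm.coe_pow]

/-- Expanding the product of the traces chooses an index at each position of each cycle, which by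
`cyclePosition` is an index at each point of `Fin t`; the cyclic shift of positions becomes `s`. -/
theorem prod_cycleTrace {t d : ℕ} (s : Equiv.Perm (Fin t))
    (M : Fin t → Matrix (Fin d) (Fin d) ℝ) :
    ∏ c : Cycles s, cycleTrace s M c = permContraction s M := by
  have h : ∀ c : Cycles s, cycleTrace s M c =
      ∑ k : Fin (Function.minimalPeriod s c.out) → Fin d,
        ∏ j, M (cyclePosition s ⟨c, j⟩) (k j) (k (finRotate _ j)) := fun c => by
    conv_lhs => rw [← Quotient.out_eq c]
    exact trace_prod_range (minimalPeriod_pos s _) fun j => M ((s ^ j) c.out)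
  classical
  simp only [h]
  rw [Fintype.prod_sum, permContraction,
    ← (Equiv.arrowCongr (cyclePosition s) (Equiv.refl (Fin d))).sum_comp,
    ← (Equiv.piCurry fun (c : Cycles s) (_ : Fin (Function.minimalPeriod s c.out)) =>
      Fin d).sum_comp]
  refine Finset.sum_congr rfl fun k _ => ?_
  rw [← (cyclePosition s).prod_comp, Fintype.prod_sigma]
  refine Finset.prod_congr rfl fun c _ => Finset.prod_congr rfl fun j _ => ?_
  rw [← cyclePosition_finRotate]
  simp [Sigma.curry]

theorem permContraction_one {t : ℕ} (d : ℕ) (s : Equiv.Perm (Fin t)) :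
    permContraction s (fun _ => (1 : Matrix (Fin d) (Fin d) ℝ)) =
      (d : ℝ) ^ Fintype.card (Cycles s) := by
  rw [← prod_cycleTrace, Finset.prod_congr rfl (g := fun _ => (d : ℝ))]
  · simp
  · intro c _
    induction c using Quotient.inductionOn
    simp [cycleTrace, cycleTraceAt]

/-! ### The parts of the partition of a permutation -/

-- `Equiv.Perm.partition` is the cycle type padded with ones. Orbits inside the support match the
-- cycle factors, the others match the fixed points. In this form the partition depends on `s` only
-- through its orbits.
open Classical in
theorem parts_partition_eq {t : ℕ} (s : Equiv.Perm (Fin t)) :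
    s.partition.parts = (Finset.univ : Finset (Cycles s)).val.map fun c =>
      ({y | Quotient.mk (Equiv.Perm.SameCycle.setoid s) y = c} : Finset (Fin t)).card := by
  set q : Fin t → Cycles s := Quotient.mk (Equiv.Perm.SameCycle.setoid s) with hq
  have hqe : ∀ x y, q x = q y ↔ s.SameCycle x y := fun x y =>
    Quotient.eq (r := Equiv.Perm.SameCycle.setoid s)
  have hout : ∀ c : Cycles s, q c.out = c := fun c => Quotient.out_eq c
  have hcard : ∀ x ∈ s.support,
      ({y | q y = q x} : Finset (Fin t)) = (s.cycleOf x).support := fun x hx => by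
    ext y
    rw [Finset.mem_filter, Equiv.Perm.mem_support_cycleOf_iff, hqe]
    simp only [Finset.mem_univ, true_and, hx, and_true]
    exact ⟨fun h => h.symm, fun h => h.symm⟩
  have hfix : ∀ x ∉ s.support, ({y | q y = q x} : Finset (Fin t)) = {x} := fun x hx => by
    ext y
    rw [Finset.mem_filter, Finset.mem_singleton, hqe]
    simp only [Finset.mem_univ, true_and]
    refine ⟨fun h => ?_, fun h => h ▸ Equiv.Perm.SameCycle.refl _ _⟩
    exact (h.symm.eq_of_left (Equiv.Perm.notMem_support.1 hx)).symm
  have hsupp : ∀ x y, q x = q y → (x ∈ s.support ↔ y ∈ s.support) := fun x y h => by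
    rw [Equiv.Perm.mem_support, Equiv.Perm.mem_support, not_iff_not]
    exact ((hqe x y).1 h).apply_eq_self_iff
  rw [Equiv.Perm.parts_partition, ← Multiset.filter_add_not (fun c : Cycles s => c.out ∈ s.support)
    Finset.univ.val, Multiset.map_add]
  congr 1
  · rw [Equiv.Perm.cycleType_def]
    symm
    refine Multiset.map_eq_map_of_bij_of_nodup _ _ (Multiset.Nodup.filter _ Finset.univ.nodup)
      s.cycleFactorsFinset.nodup (fun c _ => s.cycleOf c.out) ?_ ?_ ?_ ?_
    · intro c hc
      exact Equiv.Perm.cycleOf_mem_cycleFactorsFinset_iff.2 (Multiset.mem_filter.1 hc).2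
    · intro c hc c' hc' h
      have h1 := (Multiset.mem_filter.1 hc).2
      have h2 : c.out ∈ (s.cycleOf c'.out).support := by
        rw [← h]
        exact Equiv.Perm.mem_support_cycleOf_iff.2 ⟨Equiv.Perm.SameCycle.refl _ _, h1⟩
      rw [← hout c, ← hout c', hqe]
      exact (Equiv.Perm.mem_support_cycleOf_iff.1 h2).1.symm
    · intro g hg
      have hg' : g ∈ s.cycleFactorsFinset := hg
      have hcyc := (Equiv.Perm.mem_cycleFactorsFinset_iff.1 hg').1
      obtain ⟨x, hx⟩ := hcyc.nonempty_support
      have hxs := Equiv.Perm.mem_cycleFactorsFinset_support_le hg' hx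
      refine ⟨q x, Multiset.mem_filter.2 ⟨Finset.mem_univ _, (hsupp _ _ (hout _)).2 hxs⟩, ?_⟩
      rw [Equiv.Perm.cycle_is_cycleOf hx hg']
      exact ((hqe _ _).1 (hout (q x))).cycleOf_eq
    · intro c hc
      have := hcard c.out (Multiset.mem_filter.1 hc).2
      rw [hout] at this
      rw [this]
      rfl
  · have : Fintype.card (Fin t) - s.support.card = (s.supportᶜ).card := by
      rw [Finset.card_compl]
    rw [this]
    rw [← Finset.card_val, ← Multiset.map_const' _ 1]
    symm
    refine Multiset.map_eq_map_of_bij_of_nodup _ _ (Multiset.Nodup.filter _ Finset.univ.nodup)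
      (s.supportᶜ).nodup (fun c _ => c.out) ?_ ?_ ?_ ?_
    · intro c hc
      exact Finset.mem_compl.2 (Multiset.mem_filter.1 hc).2
    · intro c _ c' _ h
      rw [← hout c, ← hout c', h]
    · intro x hx
      have hx' : x ∉ s.support := Finset.mem_compl.1 hx
      have h1 : (q x).out ∉ s.support := fun h => hx' ((hsupp _ _ (hout _)).1 h)
      refine ⟨q x, Multiset.mem_filter.2 ⟨Finset.mem_univ _, h1⟩, ?_⟩
      have : (q x).out ∈ ({y | q y = q x} : Finset (Fin t)) := by simp [hout]
      rw [hfix x hx'] at this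
      exact Finset.mem_singleton.1 this
    · intro c hc
      have := hfix c.out (Multiset.mem_filter.1 hc).2
      rw [hout] at this
      rw [this]
      simp

theorem card_parts_partition {t : ℕ} (s : Equiv.Perm (Fin t)) :
    s.partition.parts.card = Fintype.card (Cycles s) := by
  rw [parts_partition_eq, Multiset.card_map]
  rfl

theorem parts_partition_congr {t : ℕ} {s s' : Equiv.Perm (Fin t)}
    (h : ∀ x y, s.SameCycle x y ↔ s'.SameCycle x y) :
    s.partition.parts = s'.partition.parts := by
  rw [parts_partition_eq, parts_partition_eq]
  -- The setoids and all instances are generalised, since the two quotients are different types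
  -- until the equality of setoids is substituted.
  have e : ∀ r r' : Setoid (Fin t), r = r' → ∀ (_ : Fintype (Quotient r))
      (_ : Fintype (Quotient r')) (_ : DecidableEq (Quotient r)) (_ : DecidableEq (Quotient r')),
      ((Finset.univ : Finset (Quotient r)).val.map fun c =>
        ({y | Quotient.mk r y = c} : Finset (Fin t)).card) =
      (Finset.univ : Finset (Quotient r')).val.map fun c =>
        ({y | Quotient.mk r' y = c} : Finset (Fin t)).card := by
    rintro r _ rfl i j _ _
    obtain rfl : i = j := Subsingleton.elim _ _
    congr!
  exact e (Equiv.Perm.SameCycle.setoid s) (Equiv.Perm.SameCycle.setoid s') (Setoid.ext h) _ _ _ _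

/-- A cycle type records only parts that are at least two; since the parts sum to `t`, the remaining
ones are as many as the fixed points. -/
theorem exists_isAssociated {t : ℕ} (π : t.Partition) :
    ∃ s : Equiv.Perm (Fin t), IsAssociated s π := by
  classical
  obtain ⟨s, hs⟩ := (Equiv.Perm.exists_with_cycleType_iff (Fin t)
    (m := π.parts.filter fun n => 2 ≤ n)).2 ⟨by
      rw [Fintype.card_fin]
      conv_rhs => rw [← π.parts_sum, ← Multiset.filter_add_not (fun n => 2 ≤ n) π.parts,
        Multiset.sum_add]
      exact Nat.le_add_right _ _, fun a ha => (Multiset.mem_filter.1 ha).2⟩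
  refine ⟨s, ?_⟩
  have h1 : ∀ a ∈ π.parts.filter (fun n => ¬ 2 ≤ n), a = 1 := fun a ha => by
    have := π.parts_pos (Multiset.mem_of_mem_filter ha)
    have := (Multiset.mem_filter.1 ha).2
    omega
  have h2 := Multiset.eq_replicate_card.2 h1
  have hsum := π.parts_sum
  rw [← Multiset.filter_add_not (fun n => 2 ≤ n) π.parts, Multiset.sum_add, h2,
    Multiset.sum_replicate, smul_eq_mul, mul_one, ← hs, Equiv.Perm.sum_cycleType] at hsum
  rw [IsAssociated, Equiv.Perm.parts_partition, hs]
  conv_rhs => rw [← Multiset.filter_add_not (fun n => 2 ≤ n) π.parts, h2]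
  congr 2
  rw [Fintype.card_fin]
  omega

/-! ### The weighted sum of cycle traces and its recursion -/

section Insertion

variable {ι : Type*} [Fintype ι]

theorem permContraction_update {t : ℕ} (s : Equiv.Perm (Fin t)) (M : Fin t → Matrix ι ι ℝ)
    (j : Fin t) (A : Matrix ι ι ℝ) :
    permContraction s (Function.update M j A) =
      ∑ k : Fin t → ι, A (k j) (k (s j)) *
        ∏ i ∈ Finset.univ.erase j, M i (k i) (k (s i)) := by
  refine Finset.sum_congr rfl fun k _ => ?_
  rw [← Finset.mul_prod_erase _ _ (Finset.mem_univ j), Function.update_self]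
  congr 1
  refine Finset.prod_congr rfl fun i hi => ?_
  rw [Function.update_of_ne (Finset.ne_of_mem_erase hi)]

/-- Transposing all matrices traverses every cycle backwards. -/
theorem permContraction_transpose {t : ℕ} (s : Equiv.Perm (Fin t)) (M : Fin t → Matrix ι ι ℝ) :
    permContraction s (fun i => (M i)ᵀ) = permContraction s⁻¹ M := by
  rw [permContraction, permContraction,
    ← (Equiv.arrowCongr s (Equiv.refl ι)).sum_comp]
  refine Finset.sum_congr rfl fun k _ => Finset.prod_congr rfl fun i _ => ?_
  simp [Matrix.transpose_apply]

theorem permContraction_decomposeFin_zero {t : ℕ} (e : Equiv.Perm (Fin t))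
    (M : Fin (t + 1) → Matrix ι ι ℝ) :
    permContraction (Equiv.Perm.decomposeFin.symm (0, e)) M =
      (M 0).trace * permContraction e (Fin.tail M) := by
  rw [permContraction, sum_cons, Matrix.trace, Finset.sum_mul]
  refine Finset.sum_congr rfl fun a _ => ?_
  rw [permContraction, Finset.mul_sum]
  refine Finset.sum_congr rfl fun k _ => ?_
  rw [Fin.prod_univ_succ]
  simp [Equiv.Perm.decomposeFin_symm_apply_zero, Fin.tail]

/-- This permutation inserts `0` between `x` and `e x`, so summing over the index at `0` multiplies
`M x.succ` by `M 0`. -/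
theorem permContraction_decomposeFin_succ {t : ℕ} (e : Equiv.Perm (Fin t)) (x : Fin t)
    (M : Fin (t + 1) → Matrix ι ι ℝ) :
    permContraction (Equiv.Perm.decomposeFin.symm ((e x).succ, e)) M =
      permContraction e (Function.update (Fin.tail M) x (M x.succ * M 0)) := by
  rw [permContraction, sum_cons, permContraction_update, Finset.sum_comm]
  refine Finset.sum_congr rfl fun k _ => ?_
  rw [Matrix.mul_apply, Finset.sum_mul]
  refine Finset.sum_congr rfl fun a _ => ?_
  rw [Fin.prod_univ_succ, ← Finset.mul_prod_erase _ _ (Finset.mem_univ x)]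
  have h : ∀ i ∈ Finset.univ.erase x, M i.succ ((Fin.cons a k : Fin (t + 1) → ι) i.succ)
      ((Fin.cons a k : Fin (t + 1) → ι) (Equiv.Perm.decomposeFin.symm ((e x).succ, e) i.succ)) =
      Fin.tail M i (k i) (k (e i)) := fun i hi => by
    have hne : (e i).succ ≠ (e x).succ := fun h =>
      Finset.ne_of_mem_erase hi (e.injective (Fin.succ_injective _ h))
    rw [Equiv.Perm.decomposeFin_symm_apply_succ,
      Equiv.swap_apply_of_ne_of_ne (Fin.succ_ne_zero _) hne]
    simp [Fin.tail]
  rw [Finset.prod_congr rfl h, Equiv.Perm.decomposeFin_symm_apply_zero,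
    Equiv.Perm.decomposeFin_symm_apply_succ, Equiv.swap_apply_right]
  simp only [Fin.cons_zero, Fin.cons_succ]
  ring

end Insertion

/-- The weight `2 ^ (t - #cycles)` of a permutation. -/
noncomputable def cycleWeight {t : ℕ} (s : Equiv.Perm (Fin t)) : ℝ :=
  2 ^ t / 2 ^ Fintype.card (Cycles s)

/-- Contracting identity matrices of size two gives `2 ^ #cycles`. Inversion and insertion can thus
be tracked by the contraction identities, without counting cycles anew. -/
theorem cycleWeight_eq {t : ℕ} (s : Equiv.Perm (Fin t)) :
    cycleWeight s = 2 ^ t / permContraction s fun _ => (1 : Matrix (Fin 2) (Fin 2) ℝ) := by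
  rw [permContraction_one]
  simp [cycleWeight]

theorem cycleWeight_inv {t : ℕ} (s : Equiv.Perm (Fin t)) : cycleWeight s⁻¹ = cycleWeight s := by
  rw [cycleWeight_eq, cycleWeight_eq, ← permContraction_transpose]
  simp only [transpose_one]

theorem cycleWeight_decomposeFin_zero {t : ℕ} (e : Equiv.Perm (Fin t)) :
    cycleWeight (Equiv.Perm.decomposeFin.symm (0, e)) = cycleWeight e := by
  rw [cycleWeight_eq, cycleWeight_eq, permContraction_decomposeFin_zero, trace_one,
    Fintype.card_fin, pow_succ', Nat.cast_ofNat, mul_div_mul_left _ _ two_ne_zero]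
  rfl

theorem cycleWeight_decomposeFin_succ {t : ℕ} (e : Equiv.Perm (Fin t)) (x : Fin t) :
    cycleWeight (Equiv.Perm.decomposeFin.symm ((e x).succ, e)) = 2 * cycleWeight e := by
  rw [cycleWeight_eq, cycleWeight_eq, permContraction_decomposeFin_succ, mul_one, pow_succ',
    mul_div_assoc]
  congr 3
  exact Function.update_eq_self _ _

section CycleSum

variable {ι : Type*} [Fintype ι]

/-- The sum over all permutations of the weighted contractions. -/
noncomputable def cycleSum {t : ℕ} (M : Fin t → Matrix ι ι ℝ) : ℝ :=
  ∑ s, cycleWeight s * permContraction s M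

theorem cycleSum_succ {t : ℕ} (M : Fin (t + 1) → Matrix ι ι ℝ) :
    cycleSum M = (M 0).trace * cycleSum (Fin.tail M) +
      2 * ∑ x, cycleSum (Function.update (Fin.tail M) x (M x.succ * M 0)) := by
  rw [cycleSum, ← Equiv.Perm.decomposeFin.symm.sum_comp, Fintype.sum_prod_type,
    Fin.sum_univ_succ]
  congr 1
  · rw [cycleSum, Finset.mul_sum]
    refine Finset.sum_congr rfl fun e _ => ?_
    rw [cycleWeight_decomposeFin_zero, permContraction_decomposeFin_zero]
    ring
  · simp only [cycleSum]
    rw [Finset.sum_comm, Finset.sum_comm (s := Finset.univ (α := Fin t)), Finset.mul_sum]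
    refine Finset.sum_congr rfl fun e _ => ?_
    -- `decomposeFin` indexes by the image of `0`; the reindexing passes to the point that precedes
    -- `0`.
    rw [← Equiv.sum_comp e, Finset.mul_sum]
    refine Finset.sum_congr rfl fun x _ => ?_
    rw [cycleWeight_decomposeFin_succ, permContraction_decomposeFin_succ]
    ring

theorem cycleSum_transpose {t : ℕ} (M : Fin t → Matrix ι ι ℝ) :
    cycleSum (fun i => (M i)ᵀ) = cycleSum M := by
  rw [cycleSum, cycleSum, ← Equiv.sum_comp (Equiv.inv (Equiv.Perm (Fin t)))]
  refine Finset.sum_congr rfl fun s _ => ?_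
  rw [Equiv.inv_apply, permContraction_transpose, inv_inv, cycleWeight_inv]

theorem cycleSum_update_add {t : ℕ} (M : Fin t → Matrix ι ι ℝ) (j : Fin t) (A B : Matrix ι ι ℝ) :
    cycleSum (Function.update M j (A + B)) =
      cycleSum (Function.update M j A) + cycleSum (Function.update M j B) := by
  simp only [cycleSum, permContraction_update, ← Finset.sum_add_distrib, ← mul_add]
  refine Finset.sum_congr rfl fun s _ => ?_
  congr 1
  refine Finset.sum_congr rfl fun k _ => ?_
  rw [Matrix.add_apply, add_mul]

theorem cycleSum_update_smul {t : ℕ} (M : Fin t → Matrix ι ι ℝ) (j : Fin t) (c : ℝ)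
    (A : Matrix ι ι ℝ) :
    cycleSum (Function.update M j (c • A)) = c * cycleSum (Function.update M j A) := by
  simp only [cycleSum, permContraction_update, Finset.mul_sum]
  refine Finset.sum_congr rfl fun s _ => Finset.sum_congr rfl fun k _ => ?_
  rw [Matrix.smul_apply, smul_eq_mul]
  ring

/-- The recursion produces products that are not symmetric. Since `cycleSum` is invariant under
transposing all entries and the others are symmetric, the entry at `j` may be replaced by its
symmetric part. -/
theorem cycleSum_update_symmetrize {t : ℕ} (M : Fin t → Matrix ι ι ℝ) (hM : ∀ i, (M i).IsSymm)
    (j : Fin t) (A : Matrix ι ι ℝ) :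
    cycleSum (Function.update M j ((2⁻¹ : ℝ) • (A + Aᵀ))) = cycleSum (Function.update M j A) := by
  have h : cycleSum (Function.update M j Aᵀ) = cycleSum (Function.update M j A) := by
    rw [← cycleSum_transpose]
    congr 1
    ext1 i
    rcases eq_or_ne i j with rfl | hi
    · simp
    · simp only [Function.update_of_ne hi]
      exact hM i
  rw [cycleSum_update_smul, cycleSum_update_add, h]
  ring

end CycleSum

/-! ### Trace moments as moments of a random unit vector -/

/-- The infinitesimal rotation in the plane of the coordinates `a` and `b`. -/
def planeRotation {ι : Type*} [DecidableEq ι] (a b : ι) : Matrix ι ι ℝ :=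
  Matrix.single a b 1 - Matrix.single b a 1

theorem planeRotation_transpose {ι : Type*} [DecidableEq ι] (a b : ι) :
    (planeRotation a b)ᵀ = -planeRotation a b := by
  simp [planeRotation]

section QuadForm

variable {ι : Type*} [Fintype ι]

/-- The quadratic form of `M` at the vector `u`. -/
def quadForm (u : ι → ℝ) (M : Matrix ι ι ℝ) : ℝ := u ⬝ᵥ M *ᵥ u

theorem quadForm_eq_sum (u : ι → ℝ) (M : Matrix ι ι ℝ) :
    quadForm u M = ∑ p : ι × ι, M p.1 p.2 * (u p.1 * u p.2) := by
  rw [Fintype.sum_prod_type]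
  simp only [quadForm, dotProduct, mulVec, Finset.mul_sum]
  refine Finset.sum_congr rfl fun a _ => Finset.sum_congr rfl fun b _ => ?_
  ring

theorem quadForm_transpose (u : ι → ℝ) (M : Matrix ι ι ℝ) : quadForm u Mᵀ = quadForm u M := by
  rw [quadForm, quadForm, mulVec_transpose, dotProduct_comm, dotProduct_mulVec]

theorem quadForm_symmetrize (u : ι → ℝ) (A : Matrix ι ι ℝ) :
    quadForm u ((2⁻¹ : ℝ) • (A + Aᵀ)) = quadForm u A := by
  have h := quadForm_transpose u A
  simp only [quadForm] at *
  rw [smul_mulVec, add_mulVec, dotProduct_smul, dotProduct_add, h, smul_eq_mul]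
  ring

theorem quadForm_mul (u : ι → ℝ) {M N : Matrix ι ι ℝ} (hM : M.IsSymm) :
    quadForm u (M * N) = (M *ᵥ u) ⬝ᵥ (N *ᵥ u) := by
  rw [quadForm, ← mulVec_mulVec, dotProduct_mulVec, ← mulVec_transpose, hM.eq]

variable [DecidableEq ι]

/-- For `a ≠ b` the square is minus the projection onto the coordinate plane; for `a = b` everything
is zero. This relation makes Rodrigues' formula in `rotation_mem_orthogonalGroup` orthogonal, so no
matrix exponential is needed. -/
theorem planeRotation_cube (a b : ι) :
    planeRotation a b * planeRotation a b * planeRotation a b = -planeRotation a b := by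
  rcases eq_or_ne a b with rfl | h
  · simp [planeRotation]
  · simp [planeRotation, sub_mul, mul_sub, single_mul_single_of_ne, h, h.symm]
    abel

theorem quadForm_planeRotation (u : ι → ℝ) (N : Matrix ι ι ℝ) (a b : ι) :
    quadForm u (N * planeRotation a b - planeRotation a b * N) =
      (u ᵥ* N) a * u b - (u ᵥ* N) b * u a - (u a * (N *ᵥ u) b - u b * (N *ᵥ u) a) := by
  have h : ∀ (v w : ι → ℝ), v ⬝ᵥ planeRotation a b *ᵥ w = v a * w b - v b * w a := fun v w => by
    simp [planeRotation, sub_mulVec, single_mulVec, Function.update, dotProduct, mul_sub,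
      Finset.sum_sub_distrib]
  rw [quadForm, sub_mulVec, dotProduct_sub, ← mulVec_mulVec, ← mulVec_mulVec, h,
    dotProduct_mulVec, h]

theorem single_mul_mulVec (u : ι → ℝ) (M : Matrix ι ι ℝ) (a b c : ι) :
    ((Matrix.single a b 1 * M) *ᵥ u) c = if c = a then (M *ᵥ u) b else 0 := by
  rw [← mulVec_mulVec, single_mulVec, one_mul]
  simp [Function.update_apply]

theorem vecMul_single_mul (u : ι → ℝ) (M : Matrix ι ι ℝ) (a b c : ι) :
    (u ᵥ* (Matrix.single a b 1 * M)) c = u a * M b c := by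
  simp [vecMul, dotProduct, Matrix.mul_apply, Matrix.single_apply, ite_and]

theorem quadForm_single_mul (u : ι → ℝ) (M : Matrix ι ι ℝ) (a b : ι) :
    quadForm u (Matrix.single a b 1 * M) = u a * (M *ᵥ u) b := by
  rw [quadForm, dotProduct, Finset.sum_eq_single a]
  · rw [single_mul_mulVec, if_pos rfl]
  · intro c _ hc
    rw [single_mul_mulVec, if_neg hc, mul_zero]
  · simp

theorem sum_quadForm_planeRotation_single (u : ι → ℝ) (hu : u ⬝ᵥ u = 1) (M : Matrix ι ι ℝ) :
    ∑ a, ∑ b, quadForm u (Matrix.single a b 1 * M * planeRotation a b -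
      planeRotation a b * (Matrix.single a b 1 * M)) =
      Fintype.card ι * quadForm u M - M.trace := by
  have h1 : ∑ a, ∑ b, u a * M b a * u b = quadForm u M := by
    rw [Finset.sum_comm, quadForm_eq_sum, Fintype.sum_prod_type]
    exact Finset.sum_congr rfl fun a _ => Finset.sum_congr rfl fun b _ => by ring
  have h2 : ∑ a, ∑ b, u a * M b b * u a = M.trace := by
    have : ∀ a b, u a * M b b * u a = u a * u a * M b b := fun a b => by ring
    simp only [this]
    rw [← Finset.sum_mul_sum]
    exact (congrArg (· * M.trace) hu).trans (one_mul _)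
  have h3 : ∑ a, ∑ b, u a * (if b = a then (M *ᵥ u) b else 0) = quadForm u M := by
    simp [quadForm, dotProduct]
  have h4 : ∑ _a : ι, ∑ b, u b * (M *ᵥ u) b = Fintype.card ι * quadForm u M := by
    simp [quadForm, dotProduct]
  simp only [quadForm_planeRotation, vecMul_single_mul, single_mul_mulVec, if_true,
    Finset.sum_sub_distrib]
  rw [h1, h2, h3, h4]
  ring

theorem sum_quadForm_planeRotation_mul (u : ι → ℝ) (hu : u ⬝ᵥ u = 1) {M N : Matrix ι ι ℝ}
    (hM : M.IsSymm) (hN : N.IsSymm) :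
    ∑ a, ∑ b, quadForm u (Matrix.single a b 1 * M) *
      quadForm u (N * planeRotation a b - planeRotation a b * N) =
      2 * (quadForm u M * quadForm u N - quadForm u (M * N)) := by
  have hv : u ᵥ* N = N *ᵥ u := by rw [← mulVec_transpose, hN.eq]
  have h : ∀ a b, quadForm u (Matrix.single a b 1 * M) *
      quadForm u (N * planeRotation a b - planeRotation a b * N) =
      2 * ((u a * (N *ᵥ u) a) * (u b * (M *ᵥ u) b) -
        (u a * u a) * ((M *ᵥ u) b * (N *ᵥ u) b)) := fun a b => by
    rw [quadForm_planeRotation, quadForm_single_mul, hv]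
    ring
  simp only [h, ← Finset.mul_sum, Finset.sum_sub_distrib]
  rw [quadForm_mul u hM, ← Finset.sum_mul, ← Finset.sum_mul]
  change 2 * (quadForm u N * quadForm u M - (u ⬝ᵥ u) * ((M *ᵥ u) ⬝ᵥ (N *ᵥ u))) = _
  rw [hu]
  ring

/-- The sum of the infinitesimal rotations of a product of quadratic forms. -/
theorem sum_planeRotation_prod {t : ℕ} (u : ι → ℝ) (hu : u ⬝ᵥ u = 1)
    (M : Fin (t + 1) → Matrix ι ι ℝ) (hM : ∀ i, (M i).IsSymm) :
    ∑ a, ∑ b, ∑ i, ∏ j, quadForm u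
      (Function.update (Fin.cons (Matrix.single a b 1 * M 0) (Fin.tail M) :
          Fin (t + 1) → Matrix ι ι ℝ) i
        ((Fin.cons (Matrix.single a b 1 * M 0) (Fin.tail M) : Fin (t + 1) → Matrix ι ι ℝ) i *
          planeRotation a b - planeRotation a b *
          (Fin.cons (Matrix.single a b 1 * M 0) (Fin.tail M) :
            Fin (t + 1) → Matrix ι ι ℝ) i) j) =
      (Fintype.card ι + 2 * t) * ∏ i, quadForm u (M i) -
        (M 0).trace * ∏ i, quadForm u (Fin.tail M i) -
        2 * ∑ x, ∏ i, quadForm u (Function.update (Fin.tail M) x (M 0 * M x.succ) i) := by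
  have hupd : ∀ (x : Fin t) (A : Matrix ι ι ℝ),
      ∏ i, quadForm u (Function.update (Fin.tail M) x A i) =
        quadForm u A * ∏ i ∈ Finset.univ.erase x, quadForm u (Fin.tail M i) := fun x A => by
    rw [← Finset.mul_prod_erase _ _ (Finset.mem_univ x), Function.update_self]
    congr 1
    refine Finset.prod_congr rfl fun i hi => ?_
    rw [Function.update_of_ne (Finset.ne_of_mem_erase hi)]
  -- The summand `i = 0` yields `card ι * quadForm u (M 0)` minus the trace; each of the `t` others
  -- yields twice a difference of products, whence the factor `card ι + 2 * t`.
  simp only [Fin.sum_univ_succ (n := t), Fin.cons_zero, Fin.cons_succ, Fin.update_cons_zero,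
    ← Fin.cons_update, Fin.prod_univ_succ, hupd, Finset.sum_add_distrib, ← Finset.sum_mul]
  rw [sum_quadForm_planeRotation_single u hu]
  have h : ∀ x, ∑ a, ∑ b, quadForm u (Matrix.single a b 1 * M 0) *
      (quadForm u (Fin.tail M x * planeRotation a b - planeRotation a b * Fin.tail M x) *
        ∏ i ∈ Finset.univ.erase x, quadForm u (Fin.tail M i)) =
      2 * (quadForm u (M 0) * ∏ i, quadForm u (Fin.tail M i)) -
        2 * (quadForm u (M 0 * M x.succ) *
          ∏ i ∈ Finset.univ.erase x, quadForm u (Fin.tail M i)) := fun x => by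
    simp only [← mul_assoc, ← Finset.sum_mul]
    rw [sum_quadForm_planeRotation_mul u hu (hM 0) (N := Fin.tail M x) (hM x.succ),
      ← Finset.mul_prod_erase _ _ (Finset.mem_univ x)]
    simp only [Fin.tail]
    ring
  have hcomm : ∀ g : ι → ι → Fin t → ℝ, ∑ a, ∑ b, ∑ x, g a b x = ∑ x, ∑ a, ∑ b, g a b x :=
    fun g => (Finset.sum_congr rfl fun a _ => Finset.sum_comm).trans Finset.sum_comm
  rw [hcomm]
  simp only [h, Finset.sum_sub_distrib, ← Finset.mul_sum]
  simp [Fin.tail]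
  ring

end QuadForm

/-! ### The random unit vector -/

/-- The first column of an orthogonal matrix. -/
def firstCol {d : ℕ} (hd : 1 ≤ d) (U : orthogonalGroup (Fin d) ℝ) : Fin d → ℝ :=
  fun a => U.1 a ⟨0, hd⟩

theorem continuous_firstCol {d : ℕ} (hd : 1 ≤ d) (a : Fin d) :
    Continuous fun U => firstCol hd U a :=
  continuous_subtype_val.matrix_elem a _

theorem firstCol_dotProduct_self {d : ℕ} (hd : 1 ≤ d) (U : orthogonalGroup (Fin d) ℝ) :
    firstCol hd U ⬝ᵥ firstCol hd U = 1 := by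
  have h : U.1ᵀ * U.1 = 1 := (mem_orthogonalGroup_iff' (Fin d) ℝ).1 U.2
  have := congrFun (congrFun h ⟨0, hd⟩) ⟨0, hd⟩
  rwa [Matrix.one_apply_eq, Matrix.mul_apply] at this

theorem trace_conj_coordProj_mul {d : ℕ} (hd : 1 ≤ d) (U : orthogonalGroup (Fin d) ℝ)
    (M : Matrix (Fin d) (Fin d) ℝ) :
    ((conj U (coordProj hd)).1 * M).trace = quadForm (firstCol hd U) M := by
  have h : (conj U (coordProj hd)).1 = vecMulVec (firstCol hd U) (firstCol hd U) := by
    ext a b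
    change (U.1 * diagonal (fun i : Fin d => if (i : ℕ) < 1 then (1 : ℝ) else 0) * U.1ᵀ) a b = _
    rw [Matrix.mul_apply, Finset.sum_eq_single ⟨0, hd⟩]
    · simp [vecMulVec_apply, firstCol]
    · intro c _ hc
      have : (c : ℕ) ≠ 0 := fun h => hc (Fin.ext h)
      simp [this]
    · simp
  rw [h, vecMulVec_mul, trace_vecMulVec, quadForm, dotProduct_mulVec, dotProduct_comm]

theorem continuous_quadForm_firstCol {d : ℕ} (hd : 1 ≤ d) (M : Matrix (Fin d) (Fin d) ℝ) :
    Continuous fun U => quadForm (firstCol hd U) M := by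
  simp only [quadForm_eq_sum]
  exact continuous_finsetSum _ fun p _ => continuous_const.mul
    ((continuous_firstCol hd p.1).mul (continuous_firstCol hd p.2))

theorem integrable_of_continuous {d : ℕ} {f : orthogonalGroup (Fin d) ℝ → ℝ}
    (hf : Continuous f) : Integrable f (orthogonalHaar d) :=
  hf.integrable_of_hasCompactSupport (HasCompactSupport.of_compactSpace f)

theorem integrable_prod_quadForm {d t : ℕ} (hd : 1 ≤ d) (M : Fin t → Matrix (Fin d) (Fin d) ℝ) :
    Integrable (fun U => ∏ i, quadForm (firstCol hd U) (M i)) (orthogonalHaar d) :=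
  integrable_of_continuous
    (continuous_finsetProd _ fun i _ => continuous_quadForm_firstCol hd (M i))

theorem traceMoment_eq_integral {d t : ℕ} (hd : 1 ≤ d) (M : Fin t → Matrix (Fin d) (Fin d) ℝ) :
    traceMoment hd M = ∫ U, ∏ i, quadForm (firstCol hd U) (M i) ∂orthogonalHaar d := by
  have hc : Continuous fun P : Grassmannian 1 d => ∏ i, (P.1 * M i).trace :=
    continuous_finsetProd _ fun i _ =>
      (continuous_subtype_val.matrix_mul continuous_const).matrix_trace
  rw [traceMoment, grassmannMeasure,
    integral_map (continuous_conj _).measurable.aemeasurable hc.aestronglyMeasurable]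
  simp only [trace_conj_coordProj_mul]

/-- The moment is a polynomial in the matrix entries with constant coefficients, so it can be
differentiated in the matrices without differentiating under the integral. -/
theorem traceMoment_eq_sum {d t : ℕ} (hd : 1 ≤ d) (M : Fin t → Matrix (Fin d) (Fin d) ℝ) :
    traceMoment hd M = ∑ k : Fin t → Fin d × Fin d, (∏ i, M i (k i).1 (k i).2) *
      ∫ U, ∏ i, (firstCol hd U (k i).1 * firstCol hd U (k i).2) ∂orthogonalHaar d := by
  rw [traceMoment_eq_integral]
  simp only [quadForm_eq_sum, Fintype.prod_sum, Finset.prod_mul_distrib]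
  rw [integral_finsetSum]
  · simp only [integral_const_mul]
  · intro k _
    refine integrable_of_continuous (continuous_const.mul (Continuous.mul ?_ ?_)) <;>
      exact continuous_finsetProd _ fun i _ => continuous_firstCol hd _

theorem traceMoment_conj {d t : ℕ} (hd : 1 ≤ d) (M : Fin t → Matrix (Fin d) (Fin d) ℝ)
    {V : Matrix (Fin d) (Fin d) ℝ} (hV : V ∈ orthogonalGroup (Fin d) ℝ) :
    traceMoment hd (fun i => Vᵀ * M i * V) = traceMoment hd M := by
  have hc : Continuous fun P : Grassmannian 1 d => ∏ i, (P.1 * M i).trace :=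
    continuous_finsetProd _ fun i _ =>
      (continuous_subtype_val.matrix_mul continuous_const).matrix_trace
  have hconj : Continuous (conj ⟨V, hV⟩ : Grassmannian 1 d → Grassmannian 1 d) := by
    refine Continuous.subtype_mk ?_ _
    exact (continuous_const.matrix_mul continuous_subtype_val).matrix_mul continuous_const
  rw [traceMoment, traceMoment]
  conv_rhs => rw [← grassmannMeasure_map_conj hd ⟨V, hV⟩,
    integral_map hconj.measurable.aemeasurable hc.aestronglyMeasurable]
  congr 1
  ext P
  refine Finset.prod_congr rfl fun i _ => ?_
  change _ = (V * P.1 * Vᵀ * M i).trace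
  rw [Matrix.mul_assoc V, Matrix.mul_assoc V, trace_mul_comm V]
  simp only [Matrix.mul_assoc]

/-! ### Infinitesimal rotation invariance and the moment recursion -/

theorem rotation_mem_orthogonalGroup {d : ℕ} {A : Matrix (Fin d) (Fin d) ℝ} (hA : Aᵀ = -A)
    (hA3 : A * A * A = -A) (θ : ℝ) :
    1 + Real.sin θ • A + (1 - Real.cos θ) • (A * A) ∈ orthogonalGroup (Fin d) ℝ := by
  have hA4 : A * A * (A * A) = -(A * A) := by
    rw [← Matrix.mul_assoc, hA3, neg_mul]
  have hA3' : A * (A * A) = -A := by rw [← Matrix.mul_assoc, hA3]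
  have h : (1 + Real.sin θ • A + (1 - Real.cos θ) • (A * A))ᵀ =
      1 - Real.sin θ • A + (1 - Real.cos θ) • (A * A) := by
    simp [transpose_add, transpose_smul, transpose_mul, hA, sub_eq_add_neg]
  rw [mem_orthogonalGroup_iff, h]
  calc _ = 1 + (1 - (Real.sin θ ^ 2 + Real.cos θ ^ 2)) • (A * A) := by
        simp only [add_mul, mul_add, mul_sub, smul_mul_assoc, mul_smul_comm, one_mul, mul_one,
          hA3, hA3', hA4]
        module
    _ = 1 := by rw [Real.sin_sq_add_cos_sq, sub_self, zero_smul, add_zero]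

/-- The rotation invariance of the trace moments, in infinitesimal form. -/
theorem sum_traceMoment_commutator {d t : ℕ} (hd : 1 ≤ d)
    (M : Fin t → Matrix (Fin d) (Fin d) ℝ) {A : Matrix (Fin d) (Fin d) ℝ} (hA : Aᵀ = -A)
    (hA3 : A * A * A = -A) :
    ∑ i, traceMoment hd (Function.update M i (M i * A - A * M i)) = 0 := by
  set B : ℝ → Fin t → Matrix (Fin d) (Fin d) ℝ := fun θ i =>
    (1 + Real.sin θ • A + (1 - Real.cos θ) • (A * A))ᵀ * M i *
      (1 + Real.sin θ • A + (1 - Real.cos θ) • (A * A)) with hB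
  have hB0 : B 0 = M := by
    ext1 i
    simp [hB]
  have hBeq : ∀ θ i, B θ i = M i + Real.sin θ • (M i * A - A * M i) +
      (1 - Real.cos θ) • (M i * (A * A) + A * A * M i) -
      (Real.sin θ * Real.sin θ) • (A * M i * A) +
      (Real.sin θ * (1 - Real.cos θ)) • (A * A * M i * A - A * M i * (A * A)) +
      ((1 - Real.cos θ) * (1 - Real.cos θ)) • (A * A * M i * (A * A)) := fun θ i => by
    have h : (1 + Real.sin θ • A + (1 - Real.cos θ) • (A * A))ᵀ =
        1 - Real.sin θ • A + (1 - Real.cos θ) • (A * A) := by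
      simp [transpose_add, transpose_smul, transpose_mul, hA, sub_eq_add_neg]
    simp only [hB, h, add_mul, mul_add, sub_mul, smul_mul_assoc, mul_smul_comm, one_mul, mul_one]
    module
  have hderiv : ∀ i a b, HasDerivAt (fun θ => B θ i a b) ((M i * A - A * M i) a b) 0 := by
    intro i a b
    simp only [hBeq, Matrix.add_apply, Matrix.sub_apply, Matrix.smul_apply, smul_eq_mul]
    have hs : HasDerivAt Real.sin 1 0 := by simpa using Real.hasDerivAt_sin 0
    have hr : HasDerivAt (fun θ => 1 - Real.cos θ) 0 0 := by
      simpa using (Real.hasDerivAt_cos 0).const_sub 1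
    convert! (((((hasDerivAt_const (0 : ℝ) (M i a b)).add
      (hs.mul_const ((M i * A) a b - (A * M i) a b))).add
      (hr.mul_const ((M i * (A * A)) a b + (A * A * M i) a b))).sub
      ((hs.mul hs).mul_const ((A * M i * A) a b))).add
      ((hs.mul hr).mul_const ((A * A * M i * A) a b - (A * M i * (A * A)) a b))).add
      ((hr.mul hr).mul_const ((A * A * M i * (A * A)) a b)) using 1
    simp
  have hconst : ∀ θ, traceMoment hd (B θ) = traceMoment hd M := fun θ =>
    traceMoment_conj hd M (rotation_mem_orthogonalGroup hA hA3 θ)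
  have hd1 : HasDerivAt (fun θ => traceMoment hd (B θ))
      (∑ i, traceMoment hd (Function.update M i (M i * A - A * M i))) 0 := by
    simp only [traceMoment_eq_sum]
    rw [Finset.sum_comm]
    refine HasDerivAt.fun_sum fun k _ => ?_
    rw [← Finset.sum_mul]
    refine HasDerivAt.mul_const ?_ _
    convert! HasDerivAt.fun_finsetProd (u := Finset.univ)
      (fun i _ => hderiv i (k i).1 (k i).2) using 1
    refine Finset.sum_congr rfl fun i _ => ?_
    rw [← Finset.mul_prod_erase _ _ (Finset.mem_univ i), Function.update_self, hB0, smul_eq_mul,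
      mul_comm]
    congr 1
    refine Finset.prod_congr rfl fun j hj => ?_
    rw [Function.update_of_ne (Finset.ne_of_mem_erase hj)]
  simp only [hconst] at hd1
  exact hd1.unique (hasDerivAt_const _ _)

theorem traceMoment_succ {d t : ℕ} (hd : 1 ≤ d) (M : Fin (t + 1) → Matrix (Fin d) (Fin d) ℝ)
    (hM : ∀ i, (M i).IsSymm) :
    (d + 2 * t) * traceMoment hd M = (M 0).trace * traceMoment hd (Fin.tail M) +
      2 * ∑ x, traceMoment hd (Function.update (Fin.tail M) x (M 0 * M x.succ)) := by
  -- The first matrix is not symmetric in general; the commutator identity does not require it to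
  -- be.
  have h : ∀ a b : Fin d, _ := fun a b => sum_traceMoment_commutator hd
    (Fin.cons (Matrix.single a b 1 * M 0) (Fin.tail M)) (planeRotation_transpose a b)
    (planeRotation_cube a b)
  have h0 := Finset.sum_eq_zero fun a (_ : a ∈ Finset.univ) =>
    Finset.sum_eq_zero fun b (_ : b ∈ Finset.univ) => h a b
  simp only [traceMoment_eq_integral] at h0 ⊢
  have hint := fun (M' : Fin (t + 1) → Matrix (Fin d) (Fin d) ℝ) => integrable_prod_quadForm hd M'
  have hint' := fun (M' : Fin t → Matrix (Fin d) (Fin d) ℝ) => integrable_prod_quadForm hd M'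
  simp_rw [← integral_finsetSum Finset.univ fun _ _ => hint _] at h0
  rw [Finset.sum_congr rfl fun a _ => (integral_finsetSum Finset.univ fun b _ =>
      integrable_finsetSum Finset.univ fun i _ => hint _).symm,
    ← integral_finsetSum Finset.univ fun a _ => integrable_finsetSum Finset.univ fun b _ =>
      integrable_finsetSum Finset.univ fun i _ => hint _] at h0
  rw [integral_congr_ae (Filter.Eventually.of_forall fun U =>
    sum_planeRotation_prod (firstCol hd U) (firstCol_dotProduct_self hd U) M hM),
    integral_sub, integral_sub, integral_const_mul, integral_const_mul, integral_const_mul,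
    integral_finsetSum Finset.univ fun _ _ => hint' _, Fintype.card_fin] at h0
  · linarith
  · exact (hint _).const_mul _
  · exact (hint' _).const_mul _
  · exact ((hint _).const_mul _).sub ((hint' _).const_mul _)
  · exact (integrable_finsetSum Finset.univ fun _ _ => hint' _).const_mul _

/-! ### The explicit expansion -/

theorem traceMoment_zero {d : ℕ} (hd : 1 ≤ d) (M : Fin 0 → Matrix (Fin d) (Fin d) ℝ) :
    traceMoment hd M = 1 := by
  simp [traceMoment_eq_integral]

theorem cycleSum_zero {d : ℕ} (M : Fin 0 → Matrix (Fin d) (Fin d) ℝ) : cycleSum M = 1 := by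
  rw [cycleSum, Fintype.sum_unique, cycleWeight_eq, permContraction, permContraction]
  simp

theorem traceMoment_update_symmetrize {d t : ℕ} (hd : 1 ≤ d)
    (M : Fin t → Matrix (Fin d) (Fin d) ℝ) (j : Fin t) (A : Matrix (Fin d) (Fin d) ℝ) :
    traceMoment hd (Function.update M j ((2⁻¹ : ℝ) • (A + Aᵀ))) =
      traceMoment hd (Function.update M j A) := by
  rw [traceMoment_eq_integral, traceMoment_eq_integral]
  congr 1
  ext U
  refine Finset.prod_congr rfl fun i _ => ?_
  rcases eq_or_ne i j with rfl | hi
  · rw [Function.update_self, Function.update_self, quadForm_symmetrize]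
  · rw [Function.update_of_ne hi, Function.update_of_ne hi]

theorem prod_mul_traceMoment {d : ℕ} (hd : 1 ≤ d) (t : ℕ)
    (M : Fin t → Matrix (Fin d) (Fin d) ℝ) (hM : ∀ i, (M i).IsSymm) :
    (∏ k ∈ Finset.range t, ((d : ℝ) + 2 * k)) * traceMoment hd M = cycleSum M := by
  induction t with
  | zero => simp [traceMoment_zero, cycleSum_zero]
  | succ t ih =>
    have htail : ∀ i, (Fin.tail M i).IsSymm := fun i => hM i.succ
    -- The induction hypothesis covers symmetric matrices only. Both sides depend only on the
    -- symmetric part of the product, which also removes the discrepancy between `M 0 * M x.succ`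
    -- and `M x.succ * M 0`.
    have hstep : ∀ x : Fin t, (∏ k ∈ Finset.range t, ((d : ℝ) + 2 * k)) *
        traceMoment hd (Function.update (Fin.tail M) x (M 0 * M x.succ)) =
        cycleSum (Function.update (Fin.tail M) x (M x.succ * M 0)) := fun x => by
      have hT : (M 0 * M x.succ)ᵀ = M x.succ * M 0 := by
        rw [transpose_mul, (hM 0).eq, (hM x.succ).eq]
      have hT' : (M x.succ * M 0)ᵀ = M 0 * M x.succ := by
        rw [transpose_mul, (hM 0).eq, (hM x.succ).eq]
      rw [← traceMoment_update_symmetrize, ← cycleSum_update_symmetrize _ htail, hT, hT',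
        add_comm (M x.succ * M 0)]
      refine ih _ fun i => ?_
      rcases eq_or_ne i x with rfl | hi
      · rw [Function.update_self, IsSymm, transpose_smul, transpose_add, hT, hT', add_comm]
      · rw [Function.update_of_ne hi]
        exact htail i
    rw [Finset.prod_range_succ, mul_assoc, traceMoment_succ hd M hM, mul_add, cycleSum_succ,
      ← ih _ htail, ← Finset.sum_congr rfl fun x _ => hstep x, ← Finset.mul_sum]
    ring

/-! ### Matrices that detect the cycles of a permutation -/

/-- The symmetrised matrix units along the edges `i — s i`, with vertices in `Fin d`. -/
def edgeMatrix {t d : ℕ} (htd : t ≤ d) (s : Equiv.Perm (Fin t)) (i : Fin t) :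
    Matrix (Fin d) (Fin d) ℝ :=
  Matrix.single (Fin.castLE htd i) (Fin.castLE htd (s i)) 1 +
    Matrix.single (Fin.castLE htd (s i)) (Fin.castLE htd i) 1

theorem edgeMatrix_isSymm {t d : ℕ} (htd : t ≤ d) (s : Equiv.Perm (Fin t)) (i : Fin t) :
    (edgeMatrix htd s i).IsSymm := by
  rw [IsSymm, edgeMatrix, transpose_add, transpose_single, transpose_single, add_comm]

theorem edgeMatrix_nonneg {t d : ℕ} (htd : t ≤ d) (s : Equiv.Perm (Fin t)) (i : Fin t)
    (a b : Fin d) : 0 ≤ edgeMatrix htd s i a b := by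
  simp only [edgeMatrix, Matrix.add_apply, Matrix.single_apply]
  positivity

theorem permContraction_edgeMatrix_nonneg {t d : ℕ} (htd : t ≤ d) (s s' : Equiv.Perm (Fin t)) :
    0 ≤ permContraction s' (edgeMatrix htd s) :=
  Finset.sum_nonneg fun _ _ => Finset.prod_nonneg fun i _ => edgeMatrix_nonneg htd s i _ _

theorem permContraction_edgeMatrix_self_pos {t d : ℕ} (htd : t ≤ d) (s : Equiv.Perm (Fin t)) :
    0 < permContraction s (edgeMatrix htd s) := by
  refine Finset.sum_pos' (fun _ _ => Finset.prod_nonneg fun i _ => edgeMatrix_nonneg htd s i _ _)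
    ⟨Fin.castLE htd, Finset.mem_univ _, Finset.prod_pos fun i _ => ?_⟩
  simp only [edgeMatrix, Matrix.add_apply, Matrix.single_apply_same]
  exact add_pos_of_pos_of_nonneg one_pos (by rw [Matrix.single_apply]; positivity)

theorem sameCycle_of_iterate_eq {t : ℕ} {s s' : Equiv.Perm (Fin t)} {x : Fin t}
    (h : (∀ n : ℕ, (s' ^ n) x = (s ^ n) x) ∨ ∀ n : ℕ, (s' ^ n) x = (s⁻¹ ^ n) x) (y : Fin t) :
    s.SameCycle x y ↔ s'.SameCycle x y := by
  have key : ∀ r : Equiv.Perm (Fin t), (∀ n : ℕ, (s' ^ n) x = (r ^ n) x) →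
      (r.SameCycle x y ↔ s'.SameCycle x y) := fun r hr => by
    constructor <;> intro hc <;> obtain ⟨n, hn⟩ := hc.exists_nat_pow_eq
    · exact ⟨n, by rw [zpow_natCast, hr, hn]⟩
    · exact ⟨n, by rw [zpow_natCast, ← hr, hn]⟩
  rcases h with h | h
  · exact key s h
  · rw [← key s⁻¹ h, Equiv.Perm.sameCycle_inv]

/-- A nonzero term labels each `i` with an end of the edge `i — s i` and `s' i` with the other end.
As the vertices are distinct, a direction once taken persists along the cycle, so `s'` follows `s`
or `s⁻¹` there. The direction may vary between cycles, hence only the orbits are compared. -/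
theorem sameCycle_of_permContraction_ne_zero {t d : ℕ} (htd : t ≤ d) {s s' : Equiv.Perm (Fin t)}
    (h : permContraction s' (edgeMatrix htd s) ≠ 0) (x y : Fin t) :
    s.SameCycle x y ↔ s'.SameCycle x y := by
  obtain ⟨k, -, hk⟩ := Finset.exists_ne_zero_of_sum_ne_zero h
  have hinj := Fin.castLE_injective htd
  have hedge : ∀ i, (k i = Fin.castLE htd i ∧ k (s' i) = Fin.castLE htd (s i)) ∨
      (k i = Fin.castLE htd (s i) ∧ k (s' i) = Fin.castLE htd i) := fun i => by
    have hi := Finset.prod_ne_zero_iff.1 hk i (Finset.mem_univ _)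
    by_contra hc
    push Not at hc
    refine hi ?_
    rw [edgeMatrix, Matrix.add_apply, Matrix.single_apply, Matrix.single_apply, if_neg, if_neg,
      add_zero]
    · exact fun h => hc.2 h.1.symm h.2.symm
    · exact fun h => hc.1 h.1.symm h.2.symm
  have hfwd : ∀ i, k i = Fin.castLE htd i →
      s' i = s i ∧ k (s' i) = Fin.castLE htd (s' i) := fun i hi => by
    have h1 : k (s' i) = Fin.castLE htd (s i) := by
      rcases hedge i with h | h
      · exact h.2
      · rw [h.2, ← hi, h.1]
    have h2 : s' i = s i := by
      rcases hedge (s' i) with h | h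
      · exact hinj (h.1.symm.trans h1)
      -- Reversing direction forces `s' i = i`, and then `i` is fixed by `s` as well.
      · have h3 : s' i = i := s.injective (hinj (h.1.symm.trans h1))
        rw [h3] at h1 ⊢
        exact hinj (hi.symm.trans h1)
    exact ⟨h2, h2 ▸ h1⟩
  have hbwd : ∀ i, k i = Fin.castLE htd (s i) →
      s' i = s⁻¹ i ∧ k (s' i) = Fin.castLE htd (s (s' i)) := fun i hi => by
    have h1 : k (s' i) = Fin.castLE htd i := by
      rcases hedge i with h | h
      · rw [h.2, ← hi, h.1]
      · exact h.2
    have h2 : s (s' i) = i := by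
      rcases hedge (s' i) with h | h
      · have h3 : s' i = i := hinj (h.1.symm.trans h1)
        rw [h3] at h1 ⊢
        exact hinj (hi.symm.trans h1)
      · exact hinj (h.1.symm.trans h1)
    exact ⟨Equiv.Perm.eq_inv_iff_eq.2 h2, by rw [h1, h2]⟩
  refine sameCycle_of_iterate_eq ?_ y
  rcases hedge x with hx | hx
  · left
    have : ∀ n : ℕ, (s' ^ n) x = (s ^ n) x ∧ k ((s' ^ n) x) = Fin.castLE htd ((s' ^ n) x) :=
      fun n => by
        induction n with
        | zero => exact ⟨rfl, hx.1⟩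
        | succ n ih =>
          obtain ⟨h1, h2⟩ := hfwd _ ih.2
          rw [pow_succ', pow_succ', Equiv.Perm.mul_apply, Equiv.Perm.mul_apply]
          exact ⟨by rw [h1, ih.1], h2⟩
    exact fun n => (this n).1
  · right
    have : ∀ n : ℕ, (s' ^ n) x = (s⁻¹ ^ n) x ∧
        k ((s' ^ n) x) = Fin.castLE htd (s ((s' ^ n) x)) := fun n => by
      induction n with
      | zero => exact ⟨rfl, hx.1⟩
      | succ n ih =>
        obtain ⟨h1, h2⟩ := hbwd _ ih.2
        rw [pow_succ', pow_succ', Equiv.Perm.mul_apply, Equiv.Perm.mul_apply]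
        exact ⟨by rw [h1, ih.1], h2⟩
    exact fun n => (this n).1

/-! ### The coefficients of the expansion -/

/-- The coefficients of the trace expansion on the Grassmannian of lines. -/
noncomputable def lineCoeff (d : ℕ) {t : ℕ} (π : t.Partition) : ℝ :=
  (∏ k ∈ Finset.range t, ((d : ℝ) + 2 * k))⁻¹ * (2 ^ t / 2 ^ π.parts.card)

theorem prod_range_pos {d : ℕ} (hd : 1 ≤ d) (t : ℕ) :
    0 < ∏ k ∈ Finset.range t, ((d : ℝ) + 2 * k) := by
  have : (0 : ℝ) < d := by exact_mod_cast hd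
  exact Finset.prod_pos fun k _ => by positivity

theorem lineCoeff_pos {d : ℕ} (hd : 1 ≤ d) {t : ℕ} (π : t.Partition) : 0 < lineCoeff d π := by
  have := prod_range_pos hd t
  unfold lineCoeff
  positivity

/-- `s.partition` is a partition of `Fintype.card (Fin t)`, so its parts are repackaged as a
partition of `t`. -/
theorem exists_eq_isAssociated {t : ℕ} (s : Equiv.Perm (Fin t)) :
    ∃ π : t.Partition, ∀ π', IsAssociated s π' ↔ π = π' := by
  refine ⟨⟨s.partition.parts, s.partition.parts_pos, ?_⟩, fun π' => ?_⟩
  · rw [s.partition.parts_sum, Fintype.card_fin]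
  · rw [IsAssociated, Nat.Partition.ext_iff]

theorem sum_isAssociated {t : ℕ} (f : t.Partition → Equiv.Perm (Fin t) → ℝ)
    (g : Equiv.Perm (Fin t) → ℝ) (h : ∀ π s, IsAssociated s π → f π s = g s) :
    ∑ π : t.Partition, ∑ s : Equiv.Perm (Fin t) with IsAssociated s π, f π s = ∑ s, g s := by
  simp only [Finset.sum_filter]
  rw [Finset.sum_comm]
  refine Finset.sum_congr rfl fun s _ => ?_
  obtain ⟨π, hπ⟩ := exists_eq_isAssociated s
  rw [Finset.sum_eq_single π]
  · rw [if_pos ((hπ π).2 rfl), h π s ((hπ π).2 rfl)]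
  · intro π' _ hne
    rw [if_neg fun h' => hne ((hπ π').1 h').symm]
  · simp

theorem isTraceExpansion_lineCoeff {d : ℕ} (hd : 1 ≤ d) (t : ℕ) :
    IsTraceExpansion (k := 1) hd t (lineCoeff d) := by
  intro M hM
  have h : ∀ π : t.Partition, lineCoeff d π *
      ∑ s : Equiv.Perm (Fin t) with IsAssociated s π, ∏ c : Cycles s, cycleTrace s M c =
      (∏ k ∈ Finset.range t, ((d : ℝ) + 2 * k))⁻¹ *
      ∑ s : Equiv.Perm (Fin t) with IsAssociated s π,
        2 ^ t / 2 ^ π.parts.card * permContraction s M := fun π => by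
    simp only [prod_cycleTrace, lineCoeff, Finset.mul_sum, mul_assoc]
  rw [Finset.sum_congr rfl fun π _ => h π, ← Finset.mul_sum,
    sum_isAssociated _ fun s => cycleWeight s * permContraction s M]
  · exact (eq_inv_mul_iff_mul_eq₀ (prod_range_pos hd t).ne').2 (prod_mul_traceMoment hd t M hM)
  · intro π s hs
    rw [cycleWeight, ← card_parts_partition, hs]

theorem isTraceExpansion_unique {k d t : ℕ} (hk : k ≤ d) (htd : t ≤ d) {α β : t.Partition → ℝ}
    (hα : IsTraceExpansion hk t α) (hβ : IsTraceExpansion hk t β) : α = β := by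
  ext π
  obtain ⟨s, hs⟩ := exists_isAssociated π
  set f : t.Partition → ℝ := fun π' => ∑ s' : Equiv.Perm (Fin t) with IsAssociated s' π',
    ∏ c : Cycles s', cycleTrace s' (edgeMatrix htd s) c with hf
  have hpos : 0 < f π := by
    simp only [hf, prod_cycleTrace]
    exact Finset.sum_pos' (fun s' _ => permContraction_edgeMatrix_nonneg htd s s')
      ⟨s, by simpa using hs, permContraction_edgeMatrix_self_pos htd s⟩
  -- A nonvanishing contraction has the orbits of `s`, hence the partition `π`.
  have hzero : ∀ π' ≠ π, f π' = 0 := fun π' hne => by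
    simp only [hf, prod_cycleTrace]
    refine Finset.sum_eq_zero fun s' hs' => ?_
    by_contra hc
    have hs'' : s'.partition.parts = π'.parts := (Finset.mem_filter.1 hs').2
    refine hne (Nat.Partition.ext ?_)
    rw [← hs'', ← hs, parts_partition_congr (sameCycle_of_permContraction_ne_zero htd hc)]
  have hsum : ∀ γ : t.Partition → ℝ, ∑ π', γ π' * f π' = γ π * f π := fun γ =>
    Finset.sum_eq_single π (fun π' _ hne => by rw [hzero π' hne, mul_zero]) (by simp)
  have h := (hα _ (edgeMatrix_isSymm htd s)).symm.trans (hβ _ (edgeMatrix_isSymm htd s))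
  change ∑ π', α π' * f π' = ∑ π', β π' * f π' at h
  rw [hsum, hsum] at h
  exact mul_right_cancel₀ hpos.ne' h

end TraceMoments

theorem proposition3p2 (d t : ℕ) (hd : 1 ≤ d) (htd : t ≤ d) :
    (∃ α : t.Partition → ℝ, TraceMoments.IsTraceExpansion (k := 1) hd t α) ∧
      ∀ α : t.Partition → ℝ, TraceMoments.IsTraceExpansion (k := 1) hd t α →
        ∀ π : t.Partition, 0 < α π :=
  ⟨⟨_, TraceMoments.isTraceExpansion_lineCoeff hd t⟩, fun _ hα π =>
    TraceMoments.isTraceExpansion_unique hd htd hα (TraceMoments.isTraceExpansion_lineCoeff hd t) ▸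
      TraceMoments.lineCoeff_pos hd π⟩
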